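/- Let $\mathcal{M}=(V,\mathcal{I})$ be a matroid on a finite ground set $V$ and let $G=(V,E)$ be a finite graph with vertex set $V$ (loops and parallel edges are allowed), with non-negative real edge weights $w:E\to\mathbb{R}_{\ge 0}$. For $A\subseteq E$ write $w(A)=\sum_{e\in A}w(e)$; for $v\in V$ let $\deg_w(v)=w(\{e\in E: v\in e\})$ be its weighted degree; for $S\subseteq V$ let $E(S)$ be the set of edges with at least one endpoint in $S$. For a positive integer $\rho$, let $\rho\mathcal{M}=(V,\mathcal{I}_\rho)$ be the union of $\rho$ copies of $\mathcal{M}$: $S\in\mathcal{I}_\rho$ if and only if $S$ can be partitioned into $\rho$ (possibly empty) sets $S_1,\dots,S_\rho$ with $S_i\in\mathcal{I}$ for all $i$. Let $V'$ be a maximum-weight independent set of $\rho\mathcal{M}$ with respect to the weighted degrees, i.e. $V'\in\mathcal{I}_\rho$ and $\sum_{v\in V'}\deg_w(v)\ge\sum_{v\in T}\deg_w(v)$ for every $T\in\mathcal{I}_\rho$. Then $V'$ contains a $(1-1/\rho)$-approximate solution of the matroid-constrained maximum vertex cover problem $\max_{S\in\mathcal{I}} w(E(S))$: there is a set $S\subseteq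 V'$ with $S\in\mathcal{I}$ and $$w(E(S))\ \ge\ \Bigl(1-\frac1\rho\Bigr)\max_{O\in\mathcal{I}}w(E(O)).$$ -/

import Mathlib

namespace MatroidVertexCover

/-- The total weight `w(A) = ∑_{a ∈ A} w(a)` of a set `A`
(only used for finite sets, where `finsum` is the ordinary finite sum). -/
noncomputable def weight {γ : Type*} (w : γ → ℝ) (A : Set γ) : ℝ :=
  ∑ᶠ a ∈ A, w a

/-- Independence in `ρM`, the union of `ρ` copies of the matroid `M`: the set `S` can be
partitioned into `ρ` (possibly empty) pairwise disjoint independent sets of `M`. -/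
def UnionIndep {α : Type*} (M : Matroid α) (ρ : ℕ) (S : Set α) : Prop :=
  ∃ P : Fin ρ → Set α,
    (∀ i, M.Indep (P i)) ∧ (∀ i j, i ≠ j → Disjoint (P i) (P j)) ∧ ⋃ i, P i = S

/-- `S` is a maximum-weight member of the family `I` of independent sets, with respect to the
element weights `c`. -/
def IsMaxWeightIndep {α : Type*} (I : Set α → Prop) (c : α → ℝ) (S : Set α) : Prop :=
  I S ∧ ∀ T, I T → weight c T ≤ weight c S

/-- The weighted degree `deg_w(v) = w(δ(v))`, where `δ(v)` is the set of edges incident to `v`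
(so a loop at `v` is counted once). -/
noncomputable def weightedDegree {α β : Type*} (G : Graph α β) (w : β → ℝ) (v : α) : ℝ :=
  weight w (G.incidenceSet v)

/-- The set `E(S)` of edges covered by `S`, i.e. having at least one end in `S`. -/
def coveredEdges {α β : Type*} (G : Graph α β) (S : Set α) : Set β :=
  {e | e ∈ G.edgeSet ∧ ∃ v ∈ S, G.Inc e v}

/-- `S` is an `r`-approximate solution of matroid-constrained maximum vertex cover, the problem of
maximizing `w(E(S))` over the independent sets `S` of `M`: it is feasible, and its value is at
least `r` times the value of every feasible solution (equivalently, of an optimal one). -/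
def IsApproxSolution {α β : Type*} (M : Matroid α) (G : Graph α β) (w : β → ℝ) (r : ℝ)
    (S : Set α) : Prop :=
  M.Indep S ∧
    ∀ O, M.Indep O → r * weight w (coveredEdges G O) ≤ weight w (coveredEdges G S)

end MatroidVertexCover

namespace MatroidVertexCover

open Set

variable {α β : Type*}

/-! ### Weights of sets. -/

section Weight

/-! Split `V'` into disjoint independent parts `P i`. By maximality, an element of positive degree
outside `V'` is spanned in every part by elements of at least its degree (`mem_closure_part`). So
those elements of `O` outside `V'` can be exchanged into each part separately, which yields
independent sets `J i` of total degree at least that of `O` (`exists_indep_subset_union_weight_le`).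
The average of their indicators is 1 on `O ∩ V'` and, the parts being disjoint, at most `1/ρ`
elsewhere. Choosing vertices independently with these probabilities therefore wastes little on
doubly covered edges: the expected covered weight is at least `(1 - 1/ρ) w(E(O))`
(`coverage_lower_bound`). The expectation is monotone and convex along swap directions. Hence the `J
i` may be enlarged to bases of `M` restricted to `V'`, and their average rounded without loss to a
single basis (`exists_isBase_le_nsmul_indicator`). -/

lemma weight_insert {d : α → ℝ} {S : Set α} {v : α} (hv : v ∉ S) (hS : S.Finite) :
    weight d (insert v S) = d v + weight d S :=
  finsum_mem_insert d hv hS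

lemma weight_sdiff_singleton {d : α → ℝ} {S : Set α} {v : α} (hv : v ∈ S) (hS : S.Finite) :
    weight d S = d v + weight d (S \ {v}) := by
  have h := weight_insert (d := d) (S := S \ {v}) (v := v) (by simp) hS.sdiff
  rwa [insert_sdiff_singleton, insert_eq_of_mem hv] at h

lemma weight_eq_sum_indicator (w : α → ℝ) {A E : Set α} [Fintype E] (hA : A ⊆ E) :
    weight w A = ∑ e : E, w e * A.indicator 1 (e : α) := by
  have h1 : weight w A = ∑ᶠ e ∈ E, A.indicator w e := by
    rw [weight, finsum_mem_def, finsum_mem_def, indicator_indicator,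
      inter_eq_self_of_subset_right hA]
  rw [h1, ← finsum_set_coe_eq_finsum_mem, finsum_eq_sum_of_fintype]
  refine Finset.sum_congr rfl fun e _ ↦ ?_
  by_cases he : (e : α) ∈ A <;> simp [he]

end Weight

/-! ### Exchange arguments in a matroid. -/

section Exchange

/-- The symmetric exchange property of bases. -/
lemma exists_symmetric_exchange {M : Matroid α} {B₁ B₂ : Set α} (h₁ : M.IsBase B₁)
    (h₂ : M.IsBase B₂) {e : α} (he : e ∈ B₁ \ B₂) :
    ∃ f ∈ B₂ \ B₁, M.IsBase (insert f (B₁ \ {e})) ∧ M.IsBase (insert e (B₂ \ {f})) := by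
  have heE := h₁.subset_ground he.1
  have hC := h₂.fundCircuit_isCircuit heE he.2
  have hCsub := M.fundCircuit_subset_insert e B₂
  have hcl := hC.mem_closure_sdiff_singleton_of_mem (M.mem_fundCircuit e B₂)
  -- Otherwise `B₁ \ {e}` would span the rest of the circuit, hence `e` itself.
  obtain ⟨f, hfC, hf⟩ : ∃ f ∈ M.fundCircuit e B₂ \ {e}, f ∉ M.closure (B₁ \ {e}) := by
    by_contra! h
    exact h₁.indep.notMem_closure_sdiff_of_mem he.1
      (M.closure_subset_closure_of_subset_closure h hcl)
  have hfe : f ≠ e := hfC.2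
  have hfB₂ : f ∈ B₂ := (hCsub hfC.1).resolve_left hfe
  have hfB₁ : f ∉ B₁ := fun h ↦
    hf (M.mem_closure_of_mem ⟨h, hfe⟩ (sdiff_subset.trans h₁.subset_ground))
  refine ⟨f, ⟨hfB₂, hfB₁⟩,
    h₁.exchange_base_of_notMem_closure he.1 hf (h₂.subset_ground hfB₂), ?_⟩
  rw [insert_sdiff_singleton_comm hfe.symm]
  refine h₂.exchange_isBase_of_indep' hfB₂ he.2 ?_
  exact (h₂.indep.mem_fundCircuit_iff (by rwa [h₂.closure_eq]) he.2).1 hfC.1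

/-- If every element `o` of `J` outside `A ∪ I` has positive weight and is spanned by the elements
of `I` at least as heavy as `o`, then `J` can be exchanged into `A ∪ I` without losing weight. -/
lemma exists_indep_subset_union_weight_le {M : Matroid α} {d : α → ℝ} {A I : Set α}
    (hI : I ⊆ M.E) (n : ℕ) :
    ∀ J : Set α, J.Finite → M.Indep J → A ⊆ J → (J \ (A ∪ I)).ncard = n →
      (∀ o ∈ J \ (A ∪ I), o ∈ M.closure {v ∈ I | d o ≤ d v}) →
      ∃ K, A ⊆ K ∧ K ⊆ A ∪ I ∧ M.Indep K ∧ weight d J ≤ weight d K := by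
  induction n with
  | zero =>
    intro J hJf hJ hAJ hn _
    rw [ncard_eq_zero hJf.sdiff, sdiff_eq_empty] at hn
    exact ⟨J, hAJ, hn, hJ, le_rfl⟩
  | succ n ih =>
    intro J hJf hJ hAJ hn hspan
    obtain ⟨o, ho⟩ : (J \ (A ∪ I)).Nonempty := nonempty_of_ncard_ne_zero (by omega)
    -- If `J \ {o}` spanned all these elements, it would span `o`. Swapping `o` for `v` loses no
    -- weight and leaves one element fewer outside `A ∪ I`.
    obtain ⟨v, ⟨hvI, hov⟩, hv⟩ : ∃ v ∈ {v ∈ I | d o ≤ d v}, v ∉ M.closure (J \ {o}) := by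
      by_contra! h
      exact hJ.notMem_closure_sdiff_of_mem ho.1
        (M.closure_subset_closure_of_subset_closure h (hspan o ho))
    have hvE : v ∈ M.E := hI hvI
    have hoA : o ∉ A := fun h ↦ ho.2 (.inl h)
    have hvo : v ≠ o := by rintro rfl; exact ho.2 (.inr hvI)
    have hvJ : v ∉ J \ {o} := fun h ↦
      hv (M.mem_closure_of_mem h (sdiff_subset.trans hJ.subset_ground))
    have hset : insert v (J \ {o}) \ (A ∪ I) = (J \ (A ∪ I)) \ {o} := by
      ext y; simp only [mem_sdiff, mem_insert_iff, mem_union, mem_singleton_iff]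
      constructor
      · rintro ⟨rfl | h, h'⟩
        · exact (h' (.inr hvI)).elim
        · exact ⟨⟨h.1, h'⟩, h.2⟩
      · rintro ⟨⟨h, h'⟩, h''⟩
        exact ⟨.inr ⟨h, h''⟩, h'⟩
    obtain ⟨K, hAK, hKU, hK, hle⟩ := ih (insert v (J \ {o})) (hJf.sdiff.insert v)
      (((hJ.sdiff _).insert_indep_iff_of_notMem hvJ).2 ⟨hvE, hv⟩)
      (fun a ha ↦ .inr ⟨hAJ ha, fun h ↦ hoA (h ▸ ha)⟩)
      (by rw [hset, ncard_sdiff_singleton_of_mem ho, hn]; rfl)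
      (by rw [hset]; exact fun y hy ↦ hspan y hy.1)
    refine ⟨K, hAK, hKU, hK, le_trans ?_ hle⟩
    rw [weight_insert hvJ hJf.sdiff, weight_sdiff_singleton ho.1 hJf]
    linarith

end Exchange

/-! ### Maximum-weight members of the matroid union. -/

section Union

lemma weight_iUnion {ρ : ℕ} (d : α → ℝ) {P : Fin ρ → Set α} (hfin : ∀ i, (P i).Finite)
    (hdisj : ∀ i j, i ≠ j → Disjoint (P i) (P j)) :
    weight d (⋃ i, P i) = ∑ i, weight d (P i) := by
  rw [weight, finsum_mem_iUnion (fun i j hij ↦ hdisj i j hij) hfin, finsum_eq_sum_of_fintype]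
  rfl

/-- In a maximum-weight member of `ρM`, no part can be replaced by a heavier independent set that
is disjoint from the other parts. -/
lemma weight_le_weight_part {M : Matroid α} (hM : M.E.Finite) {ρ : ℕ} {d : α → ℝ}
    {P : Fin ρ → Set α} (hP : ∀ i, M.Indep (P i))
    (hdisj : ∀ i j, i ≠ j → Disjoint (P i) (P j))
    (hmax : ∀ T, UnionIndep M ρ T → weight d T ≤ weight d (⋃ i, P i))
    (i : Fin ρ) {T : Set α} (hT : M.Indep T) (hTP : ∀ j, j ≠ i → Disjoint T (P j)) :
    weight d T ≤ weight d (P i) := by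
  classical
  have hind : ∀ j, M.Indep (Function.update P i T j) := by
    intro j
    obtain rfl | hj := eq_or_ne j i
    · simpa using hT
    · simpa [hj] using hP j
  have hd : ∀ j k, j ≠ k → Disjoint (Function.update P i T j) (Function.update P i T k) := by
    intro j k hjk
    obtain rfl | hj := eq_or_ne j i
    · simpa [hjk.symm] using hTP k hjk.symm
    · obtain rfl | hk := eq_or_ne k i
      · simpa [hj] using (hTP j hj).symm
      · simpa [hj, hk] using hdisj j k hjk
  have h := hmax _ ⟨_, hind, hd, rfl⟩
  rw [weight_iUnion d (fun j ↦ hM.subset (hind j).subset_ground) hd,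
    weight_iUnion d (fun j ↦ hM.subset (hP j).subset_ground) hdisj,
    ← Finset.add_sum_erase _ _ (Finset.mem_univ i),
    ← Finset.add_sum_erase _ (fun j ↦ weight d (P j)) (Finset.mem_univ i),
    Finset.sum_congr rfl (g := fun j ↦ weight d (P j))
      (fun j hj ↦ by rw [Function.update_of_ne (Finset.ne_of_mem_erase hj)]),
    Function.update_self] at h
  linarith

/-- An element of positive weight outside a maximum-weight member of `ρM` is spanned, in each part,
by the elements that are at least as heavy. -/
lemma mem_closure_part {M : Matroid α} (hM : M.E.Finite) {ρ : ℕ} {d : α → ℝ}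
    {P : Fin ρ → Set α} (hP : ∀ i, M.Indep (P i))
    (hdisj : ∀ i j, i ≠ j → Disjoint (P i) (P j))
    (hmax : ∀ T, UnionIndep M ρ T → weight d T ≤ weight d (⋃ i, P i))
    (i : Fin ρ) {o : α} (hoE : o ∈ M.E) (ho : o ∉ ⋃ i, P i) (hpos : 0 < d o) :
    o ∈ M.closure {v ∈ P i | d o ≤ d v} := by
  have hoi : ∀ j, o ∉ P j := fun j h ↦ ho (mem_iUnion_of_mem j h)
  have hfin : (P i).Finite := hM.subset (hP i).subset_ground
  have hins : ∀ S ⊆ insert o (P i), ∀ j, j ≠ i → Disjoint S (P j) := by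
    intro S hS j hj
    refine Disjoint.mono_left hS (disjoint_insert_left.2 ⟨hoi j, hdisj i j hj.symm⟩)
  have hcl : o ∈ M.closure (P i) := by
    by_contra hcl
    have h := weight_le_weight_part hM hP hdisj hmax i
      (((hP i).insert_indep_iff_of_notMem (hoi i)).2 ⟨hoE, hcl⟩) (hins _ Subset.rfl)
    rw [weight_insert (hoi i) hfin] at h
    linarith
  have hC := (hP i).fundCircuit_isCircuit hcl (hoi i)
  refine M.closure_subset_closure ?_
    (hC.mem_closure_sdiff_singleton_of_mem (M.mem_fundCircuit o (P i)))
  -- Swapping `u` for `o` in `P i` keeps independence, so maximality forces `d o ≤ d u`.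
  rintro u ⟨huC, huo⟩
  have huo : u ≠ o := huo
  have hu : u ∈ P i := (M.fundCircuit_subset_insert o (P i) huC).resolve_left huo
  have hind := ((hP i).mem_fundCircuit_iff hcl (hoi i)).1 huC
  have h := weight_le_weight_part hM hP hdisj hmax i hind (hins _ sdiff_subset)
  rw [← insert_sdiff_singleton_comm huo.symm, weight_insert (fun h ↦ hoi i h.1) hfin.sdiff,
    weight_sdiff_singleton hu hfin] at h
  exact ⟨hu, by linarith⟩

end Union

/-! ### Rounding an average of bases to one basis. -/

section Rounding

open scoped Classical in
/-- If `Φ` is convex in the directions `δ_v - δ_u`, then it is not larger at a sum of `n` indicator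
vectors of bases than at `n` times the indicator vector of some single base. -/
lemma exists_isBase_le_nsmul_indicator {M : Matroid α} (hM : M.E.Finite) {n : ℕ} [NeZero n]
    (Φ : (α → ℝ) → ℝ)
    (hΦ : ∀ x : α → ℝ, ∀ u v, u ≠ v →
      2 * Φ x ≤ Φ (x + (Pi.single v 1 - Pi.single u 1)) + Φ (x + (Pi.single u 1 - Pi.single v 1)))
    {B₀ : Fin n → Set α} (hB₀ : ∀ i, M.IsBase (B₀ i)) :
    ∃ B, M.IsBase B ∧ Φ (∑ i, (B₀ i).indicator 1) ≤ Φ (fun v ↦ n * B.indicator 1 v) := by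
  let Q : (α → ℝ) → ℝ := fun x ↦ ∑ v ∈ hM.toFinset, x v ^ 2
  let c : (Fin n → Set α) → α → ℝ := fun B ↦ ∑ i, (B i).indicator 1
  have hfin : {B : Fin n → Set α | ∀ i, M.IsBase (B i)}.Finite := by
    refine (Set.Finite.pi' (t := fun _ : Fin n ↦ M.E.powerset)
      fun _ ↦ hM.finite_subsets).subset ?_
    exact fun B hB i ↦ (hB i).subset_ground
  -- The strictly convex `Q` breaks ties in `Φ`, where convexity alone need not be strict.
  obtain ⟨B, hB, hmax⟩ := Set.exists_max_image _ (fun B ↦ toLex (Φ (c B), Q (c B))) hfin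
    ⟨B₀, hB₀⟩
  have hupd : ∀ i u v, u ∈ B i → v ∉ B i →
      c (Function.update B i (insert v (B i \ {u}))) = c B + (Pi.single v 1 - Pi.single u 1) := by
    intro i u v hu hv
    have huv : u ≠ v := by rintro rfl; exact hv hu
    rw [← sub_eq_iff_eq_add', ← Finset.sum_sub_distrib, Fintype.sum_eq_single i]
    · ext y
      simp only [Function.update_self, Pi.sub_apply, indicator_apply, Pi.single_apply,
        mem_insert_iff, mem_sdiff, mem_singleton_iff, Pi.one_apply]
      by_cases h1 : y = v
      · subst h1; simp [hv, huv.symm]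
      · by_cases h2 : y = u
        · subst h2; simp [hu, huv]
        · simp [h1, h2]
    · intro j hj
      simp [hj]
  have hupdB : ∀ i S, M.IsBase S → ∀ j, M.IsBase (Function.update B i S j) := by
    intro i S hS j
    obtain rfl | hj := eq_or_ne j i
    · simpa using hS
    · simpa [hj] using hB j
  have hQ : ∀ x : α → ℝ, ∀ u ∈ M.E, ∀ v ∈ M.E, u ≠ v →
      2 * Q x <
        Q (x + (Pi.single v 1 - Pi.single u 1)) + Q (x + (Pi.single u 1 - Pi.single v 1)) := by
    intro x u hu v hv huv
    simp only [Q]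
    rw [Finset.mul_sum, ← Finset.sum_add_distrib]
    refine Finset.sum_lt_sum (fun y _ ↦ ?_) ⟨u, by simpa using hu, ?_⟩
    · simp only [Pi.add_apply, Pi.sub_apply]
      nlinarith [sq_nonneg ((Pi.single u 1 : α → ℝ) y - (Pi.single v 1 : α → ℝ) y)]
    · simp [huv]
      nlinarith
  -- If two bases differ, a symmetric exchange in one or the other moves `c B` by opposite vectors.
  -- By convexity of `Φ` and strict convexity of `Q`, one of the moves is a lexicographic
  -- improvement.
  have hconst : ∀ i j, B i ⊆ B j := by
    intro i j u hu
    by_contra huj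
    obtain ⟨v, hv, hi', hj'⟩ := exists_symmetric_exchange (hB i) (hB j) ⟨hu, huj⟩
    have huv : u ≠ v := by rintro rfl; exact huj hv.1
    have h1 := hmax _ (hupdB i _ hi')
    have h2 := hmax _ (hupdB j _ hj')
    simp only [hupd i u v hu hv.2, hupd j v u hv.1 huj, Prod.Lex.toLex_le_toLex] at h1 h2
    have h3 := hΦ (c B) u v huv
    have h4 := hQ (c B) u ((hB i).subset_ground hu) v ((hB j).subset_ground hv.1) huv
    rcases h1 with h1 | ⟨h1, h1'⟩ <;> rcases h2 with h2 | ⟨h2, h2'⟩ <;> linarith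
  refine ⟨B 0, hB 0, ?_⟩
  have h0 := hmax _ hB₀
  have hc : c B = fun v ↦ (n : ℝ) * (B 0).indicator 1 v := by
    ext v
    simp only [c, Finset.sum_apply]
    rw [Finset.sum_congr rfl (g := fun _ ↦ (B 0).indicator 1 v)
      (fun i _ ↦ by rw [(hconst i 0).antisymm (hconst 0 i)])]
    simp
  rw [← hc]
  rw [Prod.Lex.toLex_le_toLex] at h0
  rcases h0 with h0 | h0
  · exact h0.le
  · exact h0.1.le

end Rounding

/-! ### Expected coverage and degree sums, edge by edge. -/

section Cover

open scoped Classical in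
/-- The probability that an edge with ends `p` and `q` is covered, if the vertices are chosen
independently with probabilities `x`. -/
noncomputable def coverage (x : α → ℝ) (p q : α) : ℝ :=
  if p = q then x p else x p + x q - x p * x q

open scoped Classical in
/-- The sum of `x` over the distinct ends `p` and `q` of an edge. -/
noncomputable def endSum (x : α → ℝ) (p q : α) : ℝ :=
  if p = q then x p else x p + x q

lemma coverage_mono {x y : α → ℝ} (hxy : ∀ v, x v ≤ y v) (hy : ∀ v, y v ≤ 1) (p q : α) :
    coverage x p q ≤ coverage y p q := by
  unfold coverage
  split_ifs
  · exact hxy p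
  · nlinarith [mul_nonneg (sub_nonneg.2 (hxy p)) (sub_nonneg.2 (hy q)),
      mul_nonneg (sub_nonneg.2 (hxy q)) (sub_nonneg.2 ((hxy p).trans (hy p)))]

-- The linear terms cancel. For `p ≠ q` the quadratic term is `-r²` times the product of the entries
-- of the direction at `p` and `q`, and that product is never positive.
open scoped Classical in
lemma two_mul_coverage_le (r : ℝ) (x : α → ℝ) (u v p q : α) :
    2 * coverage (fun z ↦ r * x z) p q ≤
      coverage (fun z ↦ r * (x + (Pi.single v 1 - Pi.single u 1) : α → ℝ) z) p q +
        coverage (fun z ↦ r * (x + (Pi.single u 1 - Pi.single v 1) : α → ℝ) z) p q := by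
  unfold coverage
  split_ifs with h
  · simp only [Pi.add_apply, Pi.sub_apply]; linarith
  · simp only [Pi.add_apply, Pi.sub_apply]
    have hd : ((Pi.single v 1 : α → ℝ) p - (Pi.single u 1 : α → ℝ) p) *
        ((Pi.single v 1 : α → ℝ) q - (Pi.single u 1 : α → ℝ) q) ≤ 0 := by
      simp only [Pi.single_apply]
      split_ifs <;> norm_num
      all_goals exact h (by grind)
    nlinarith [mul_nonneg (sq_nonneg r) (neg_nonneg.2 hd)]

/-- For distinct ends this reduces to `x p * x q ≤ r * (x p + x q) + (1 - r) * (o p * o q)`. If some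
end has `x ≤ r`, the first term on the right suffices; otherwise all four values are 1. -/
lemma coverage_lower_bound {r : ℝ} (hr0 : 0 ≤ r) (hr1 : r ≤ 1) {x o : α → ℝ}
    (ho : ∀ v, o v = 0 ∨ o v = 1) (hx : ∀ v, (x v = 1 ∧ o v = 1) ∨ (0 ≤ x v ∧ x v ≤ r)) (p q : α) :
    (1 - r) * coverage o p q + (1 - r) * (endSum x p q - endSum o p q) ≤ coverage x p q := by
  unfold coverage endSum
  split_ifs with h
  · rcases hx p with ⟨h1, h2⟩ | ⟨h1, h2⟩
    · rw [h1, h2]; linarith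
    · nlinarith
  · rcases hx p with ⟨h1, h2⟩ | ⟨h1, h2⟩ <;> rcases hx q with ⟨h3, h4⟩ | ⟨h3, h4⟩
    · rw [h1, h2, h3, h4]; linarith
    · rw [h1, h2]; rcases ho q with h | h <;> rw [h] <;> nlinarith
    · rw [h3, h4]; rcases ho p with h | h <;> rw [h] <;> nlinarith
    · rcases ho p with h | h <;> rcases ho q with h' | h' <;> rw [h, h'] <;>
        nlinarith [mul_nonneg h1 (sub_nonneg.2 h4), mul_nonneg h3 (sub_nonneg.2 h2)]

lemma weight_coveredEdges_eq_sum (G : Graph α β) [Fintype G.edgeSet] (w : β → ℝ)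
    {p q : G.edgeSet → α} (hpq : ∀ e : G.edgeSet, G.IsLink e (p e) (q e)) (S : Set α) :
    weight w (coveredEdges G S) = ∑ e : G.edgeSet, w e * coverage (S.indicator 1) (p e) (q e) := by
  rw [weight_eq_sum_indicator w (E := G.edgeSet) (fun e he ↦ he.1)]
  refine Finset.sum_congr rfl fun e _ ↦ ?_
  congr 1
  have hmem : (e : β) ∈ coveredEdges G S ↔ p e ∈ S ∨ q e ∈ S := by
    refine ⟨?_, ?_⟩
    · rintro ⟨-, v, hv, hev⟩
      rcases hev.eq_or_eq_of_isLink (hpq e) with rfl | rfl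
      exacts [.inl hv, .inr hv]
    · rintro (h | h)
      exacts [⟨e.2, _, h, (hpq e).inc_left⟩, ⟨e.2, _, h, (hpq e).inc_right⟩]
  unfold coverage
  classical
  simp only [indicator_apply, hmem, Pi.one_apply]
  split_ifs <;> simp_all

open scoped Classical in
lemma weight_weightedDegree_eq_sum (G : Graph α β) [Fintype G.edgeSet] (w : β → ℝ)
    {p q : G.edgeSet → α} (hpq : ∀ e : G.edgeSet, G.IsLink e (p e) (q e)) {S : Set α}
    (hS : S.Finite) :
    weight (weightedDegree G w) S = ∑ e : G.edgeSet, w e * endSum (S.indicator 1) (p e) (q e) := by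
  have hdeg : ∀ v, weightedDegree G w v =
      ∑ e : G.edgeSet, w e * endSum (Pi.single v 1) (p e) (q e) := by
    intro v
    rw [weightedDegree, weight_eq_sum_indicator w (E := G.edgeSet) (fun e he ↦ he.edge_mem)]
    refine Finset.sum_congr rfl fun e _ ↦ ?_
    congr 1
    have hmem : (e : β) ∈ G.incidenceSet v ↔ p e = v ∨ q e = v := by
      refine ⟨fun h ↦ ?_, ?_⟩
      · exact (Graph.Inc.eq_or_eq_of_isLink h (hpq e)).imp Eq.symm Eq.symm
      · rintro (rfl | rfl)
        exacts [(hpq e).inc_left, (hpq e).inc_right]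
    simp only [indicator_apply, hmem, endSum, Pi.single_apply, Pi.one_apply]
    split_ifs <;> simp_all
  have hsum : ∀ y, ∑ v ∈ hS.toFinset, (Pi.single v 1 : α → ℝ) y = S.indicator 1 y := by
    intro y
    simp [Pi.single_apply, indicator_apply]
  rw [weight, finsum_mem_eq_finite_toFinset_sum _ hS]
  simp only [hdeg]
  rw [Finset.sum_comm]
  refine Finset.sum_congr rfl fun e _ ↦ ?_
  rw [← Finset.mul_sum]
  congr 1
  unfold endSum
  split_ifs
  · exact hsum _
  · rw [Finset.sum_add_distrib, hsum, hsum]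

end Cover

/-! ### Combining exchange, coverage and rounding. -/

section Main

/-- For each independent set `O`, a maximum-weight member of `ρM` for the weighted degrees contains
an independent set that covers all but a fraction `1 / ρ` of the weight covered by `O`. -/
lemma exists_indep_subset_le_weight_coveredEdges {M : Matroid α} (hM : M.E.Finite)
    {G : Graph α β} (hE : G.edgeSet.Finite) {w : β → ℝ} (hw : ∀ e ∈ G.edgeSet, 0 ≤ w e)
    {ρ : ℕ} (hρ : 0 < ρ) {V' : Set α}
    (hV' : IsMaxWeightIndep (UnionIndep M ρ) (weightedDegree G w) V') {O : Set α}
    (hO : M.Indep O) :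
    ∃ S ⊆ V', M.Indep S ∧
      (1 - 1 / (ρ : ℝ)) * weight w (coveredEdges G O) ≤ weight w (coveredEdges G S) := by
  classical
  have : Fintype G.edgeSet := hE.fintype
  have : NeZero ρ := ⟨hρ.ne'⟩
  choose p q hpq using fun e : G.edgeSet ↦ G.exists_isLink_of_mem_edgeSet e.2
  obtain ⟨⟨P, hP, hdisj, rfl⟩, hmax⟩ := hV'
  set r : ℝ := 1 / (ρ : ℝ) with hr
  have hρ' : (0 : ℝ) < ρ := by exact_mod_cast hρ
  have hr0 : 0 ≤ r := by positivity
  have hrρ : r * ρ = 1 := by rw [hr]; field_simp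
  have hr1 : r ≤ 1 := by
    rw [hr, div_le_one hρ']
    exact_mod_cast hρ
  have hVE : ⋃ i, P i ⊆ M.E := iUnion_subset fun i ↦ (hP i).subset_ground
  have hfin : ∀ {S}, M.Indep S → S.Finite := fun h ↦ hM.subset h.subset_ground
  have hdeg : ∀ v, 0 ≤ weightedDegree G w v := fun v ↦
    finsum_nonneg fun e ↦ finsum_nonneg fun he ↦ hw e (Graph.Inc.edge_mem he)
  -- vertices of degree zero outside `V'` can be discarded from `O`
  let A := O ∩ ⋃ i, P i
  let O₁ := {v ∈ O | v ∈ ⋃ i, P i ∨ 0 < weightedDegree G w v}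
  have hO₁ : M.Indep O₁ := hO.subset (sep_subset _ _)
  have hOO₁ : weight (weightedDegree G w) O = weight (weightedDegree G w) O₁ := by
    refine finsum_mem_inter_support_eq' _ _ _ fun v hv ↦ ?_
    exact ⟨fun h ↦ ⟨h, .inr ((hdeg v).lt_of_ne' hv)⟩, fun h ↦ h.1⟩
  have hJ : ∀ i, ∃ J, A ⊆ J ∧ J ⊆ A ∪ P i ∧ M.Indep J ∧
      weight (weightedDegree G w) O₁ ≤ weight (weightedDegree G w) J := by
    intro i
    refine exists_indep_subset_union_weight_le (hP i).subset_ground _ O₁ (hfin hO₁) hO₁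
      (fun v hv ↦ ⟨hv.1, .inl hv.2⟩) rfl ?_
    rintro o ⟨⟨hoO, ho⟩, hoA⟩
    have hoV : o ∉ ⋃ i, P i := fun h ↦ hoA (.inl ⟨hoO, h⟩)
    exact mem_closure_part hM hP hdisj hmax i (hO.subset_ground hoO) hoV (ho.resolve_left hoV)
  choose J hAJ hJA hJ hJw using hJ
  have hJV : ∀ i, J i ⊆ ⋃ i, P i := fun i ↦
    (hJA i).trans (union_subset inter_subset_right (subset_iUnion P i))
  have hB : ∀ i, ∃ B, (M.restrict (⋃ i, P i)).IsBase B ∧ J i ⊆ B := fun i ↦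
    (Matroid.restrict_indep_iff.2 ⟨hJ i, hJV i⟩).exists_isBase_superset
  choose B hB hJB using hB
  let c : (Fin ρ → Set α) → α → ℝ := fun K v ↦ r * (∑ i, (K i).indicator 1 : α → ℝ) v
  let Φ : (α → ℝ) → ℝ := fun x ↦ ∑ e : G.edgeSet, w e * coverage (fun v ↦ r * x v) (p e) (q e)
  obtain ⟨S, hS, hSle⟩ := exists_isBase_le_nsmul_indicator
    (M := M.restrict (⋃ i, P i)) (hM.subset hVE) Φ
    (fun x u v _ ↦ by
      simp only [Φ]
      rw [Finset.mul_sum, ← Finset.sum_add_distrib]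
      refine Finset.sum_le_sum fun e _ ↦ ?_
      nlinarith [mul_le_mul_of_nonneg_left (two_mul_coverage_le r x u v (p e) (q e))
        (hw e e.2)]) hB
  have hSi := Matroid.restrict_indep_iff.1 hS.indep
  refine ⟨S, hSi.2, hSi.1, ?_⟩
  have hΦS : Φ (fun v ↦ ρ * S.indicator 1 v) = weight w (coveredEdges G S) := by
    simp only [Φ, weight_coveredEdges_eq_sum G w hpq, ← mul_assoc, hrρ, one_mul]
  rw [hΦS] at hSle
  refine le_trans ?_ hSle
  have hcJB : ∀ v, c J v ≤ c B v := by
    intro v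
    simp only [c, Finset.sum_apply]
    refine mul_le_mul_of_nonneg_left (Finset.sum_le_sum fun i _ ↦ ?_) hr0
    exact indicator_le_indicator_of_subset (hJB i) (fun _ ↦ zero_le_one' ℝ) v
  have hcB : ∀ v, c B v ≤ 1 := by
    intro v
    simp only [c, Finset.sum_apply]
    rw [← hrρ]
    gcongr
    refine (Finset.sum_le_card_nsmul _ _ 1 fun i _ ↦ ?_).trans (by simp)
    by_cases h : v ∈ B i <;> simp [h]
  -- All `ρ` sets `J i` contain `A`; outside `A` each lies in its own `P i`, so at most one contains
  -- `v`.
  have hcJ : ∀ v, (c J v = 1 ∧ O.indicator (1 : α → ℝ) v = 1) ∨ (0 ≤ c J v ∧ c J v ≤ r) := by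
    intro v
    simp only [c, Finset.sum_apply]
    by_cases hv : v ∈ A
    · left
      refine ⟨?_, by simp [hv.1]⟩
      simp [fun i ↦ hAJ i hv, hrρ]
    · right
      refine ⟨mul_nonneg hr0 (Finset.sum_nonneg fun i _ ↦
        indicator_nonneg (fun _ _ ↦ zero_le_one' ℝ) v), mul_le_of_le_one_right hr0 ?_⟩
      have hJP : ∀ i, v ∈ J i → v ∈ P i := fun i h ↦ (hJA i h).resolve_left hv
      by_cases h : ∃ i, v ∈ J i
      · obtain ⟨i, hi⟩ := h
        rw [Fintype.sum_eq_single i]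
        · simp [hi]
        · intro j hj
          exact indicator_of_notMem
            (fun h ↦ (disjoint_left.1 (hdisj j i hj) (hJP j h) (hJP i hi))) _
      · push Not at h
        simp [h]
  -- `endSum` is linear, so the right side is the average degree weight of the `J i`.
  have hsum : ∑ e : G.edgeSet, w e * endSum (O.indicator 1) (p e) (q e) ≤
      ∑ e : G.edgeSet, w e * endSum (c J) (p e) (q e) := by
    rw [← weight_weightedDegree_eq_sum G w hpq (hfin hO), hOO₁]
    have h1 : ∑ e : G.edgeSet, w e * endSum (c J) (p e) (q e) =
        r * ∑ i, weight (weightedDegree G w) (J i) := by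
      simp only [weight_weightedDegree_eq_sum G w hpq (hfin (hJ _))]
      rw [Finset.sum_comm, Finset.mul_sum]
      refine Finset.sum_congr rfl fun e _ ↦ ?_
      rw [← Finset.mul_sum, mul_left_comm]
      congr 1
      unfold endSum
      split_ifs
      · simp [c]
      · simp [c, Finset.sum_add_distrib, mul_add]
    rw [h1]
    calc _ = r * ∑ _i : Fin ρ, weight (weightedDegree G w) O₁ := by
          rw [Finset.sum_const, Finset.card_univ, Fintype.card_fin, nsmul_eq_mul, ← mul_assoc,
            hrρ, one_mul]
      _ ≤ _ := by gcongr with i; exact hJw i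
  have hcov : ∑ e : G.edgeSet, w e * ((1 - r) * coverage (O.indicator 1) (p e) (q e) +
      (1 - r) * (endSum (c J) (p e) (q e) - endSum (O.indicator 1) (p e) (q e))) ≤
      ∑ e : G.edgeSet, w e * coverage (c B) (p e) (q e) := by
    refine Finset.sum_le_sum fun e _ ↦ mul_le_mul_of_nonneg_left ?_ (hw e e.2)
    refine (coverage_lower_bound hr0 hr1 (fun v ↦ ?_) hcJ _ _).trans (coverage_mono hcJB hcB _ _)
    by_cases h : v ∈ O <;> simp [h]
  refine le_trans ?_ hcov
  rw [weight_coveredEdges_eq_sum G w hpq]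
  simp only [mul_add, mul_sub, mul_left_comm _ (1 - r), Finset.sum_add_distrib,
    Finset.sum_sub_distrib, ← Finset.mul_sum]
  -- By `hsum` the summed degree correction is nonnegative and can be dropped.
  nlinarith [mul_le_mul_of_nonneg_left hsum (sub_nonneg.2 hr1)]

end Main

end MatroidVertexCover

theorem mainTheorem5 {α β : Type*} (M : Matroid α) (hM : M.E.Finite)
    (G : Graph α β) (hV : G.vertexSet = M.E) (hE : G.edgeSet.Finite)
    (w : β → ℝ) (hw : ∀ e ∈ G.edgeSet, 0 ≤ w e)
    (ρ : ℕ) (hρ : 0 < ρ) (V' : Set α)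
    (hV' : MatroidVertexCover.IsMaxWeightIndep (MatroidVertexCover.UnionIndep M ρ)
      (MatroidVertexCover.weightedDegree G w) V') :
    ∃ S ⊆ V', MatroidVertexCover.IsApproxSolution M G w (1 - 1 / (ρ : ℝ)) S := by
  -- The set `S` depends on `O`, so an optimal `O` is fixed to obtain one `S` for all competitors.
  obtain ⟨O, hO, hOmax⟩ := Set.exists_max_image {O | M.Indep O}
    (fun O ↦ MatroidVertexCover.weight w (MatroidVertexCover.coveredEdges G O))
    (hM.finite_subsets.subset fun _ h ↦ h.subset_ground) ⟨∅, M.empty_indep⟩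
  obtain ⟨S, hSV, hS, hle⟩ :=
    MatroidVertexCover.exists_indep_subset_le_weight_coveredEdges hM hE hw hρ hV' hO
  refine ⟨S, hSV, hS, fun T hT ↦ le_trans ?_ hle⟩
  refine mul_le_mul_of_nonneg_left (hOmax T hT) (sub_nonneg.2 ?_)
  rw [div_le_one (by exact_mod_cast hρ)]
  exact_mod_cast hρ
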